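/- Let $\mathcal H_A,\mathcal H_B,\mathcal H_E$ be complex Hilbert spaces. Let $G=\sum_j g_j|e_j\rangle\langle e_j|$ be an energy observable on $\mathcal H_A$, where $\{|e_j\rangle\}_j$ is an orthonormal basis and $g_j\ge 0$, and suppose that $G$ is a Gibbs observable: $\operatorname{Tr}\{e^{-\beta G}\}<\infty$ for all $\beta>0$. Let $P\in[0,\infty)$, and let $\mathcal N:\mathcal T(\mathcal H_A)\to\mathcal T(\mathcal H_B)$ be a quantum channel (a completely positive, trace-preserving linear map between the spaces of trace-class operators) that satisfies the finite-output-entropy condition $$\sup_{\rho:\ \operatorname{Tr}\{G\rho\}\le P} H(\mathcal N(\rho))<\infty .$$ Then every complementary channel $\hat{\mathcal N}:\mathcal T(\mathcal H_A)\to\mathcal T(\mathcal H_E)$ of $\mathcal N$ satisfies $$\sup_{\rho:\ \operatorname{Tr}\{G\rho\}\le P} H(\hat{\mathcal N}(\rho))<\infty .$$ Here the suprema run over density operators $\rho$ on $\mathcal H_A$ (the supremum of the empty set being $0$); $\operatorname{Tr}\{G\rho\}=\sup_n\operatorname{Tr}\{\Pi_nG\Pi_n\rho\}$, with $\Pi_n$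 the spectral projection of $G$ for the interval $[0,n]$; $H(\sigma)=\operatorname{Tr}\{\eta(\sigma)\}\in[0,\infty]$, with $\eta(x)=-x\log_2x$ for $x>0$ and $\eta(0)=0$; and $\hat{\mathcal N}$ is complementary to $\mathcal N$ if for some linear isometry $U:\mathcal H_A\to\mathcal H_B\otimes\mathcal H_E$ one has $\mathcal N(\tau)=\operatorname{Tr}_E\{U\tau U^\dagger\}$ and $\hat{\mathcal N}(\tau)=\operatorname{Tr}_B\{U\tau U^\dagger\}$ for all $\tau\in\mathcal T(\mathcal H_A)$. -/

import Mathlib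

open scoped ENNReal NNReal TensorProduct ComplexOrder

noncomputable section

namespace QInfo

section TraceClass

variable (H : Type*) [NormedAddCommGroup H] [InnerProductSpace ℂ H] [CompleteSpace H]

/-- Index set of a fixed orthonormal basis of `H`. -/
def stdIndex : Set H := Classical.choose (exists_hilbertBasis ℂ H)

/-- A fixed orthonormal basis of `H`, used to compute traces. -/
def stdBasis : HilbertBasis (stdIndex H) ℂ H :=
  Classical.choose (Classical.choose_spec (exists_hilbertBasis ℂ H))

variable {H}

/-- The trace `∑ᵢ ⟨eᵢ, T eᵢ⟩ ∈ [0, ∞]` of a positive operator `T`. -/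
def posTrace (T : H →L[ℂ] H) : ℝ≥0∞ :=
  ∑' i, ENNReal.ofReal (inner ℂ (stdBasis H i) (T (stdBasis H i))).re

/-- The trace norm `Tr |T|`, where `|T| = √(T† T)`. -/
def traceNorm (T : H →L[ℂ] H) : ℝ≥0∞ := posTrace (CFC.abs T)

/-- The trace `∑ᵢ ⟨eᵢ, T eᵢ⟩` of a trace-class operator `T`. -/
def trace (T : H →L[ℂ] H) : ℂ := ∑' i, inner ℂ (stdBasis H i) (T (stdBasis H i))

lemma parseval {ι : Type*} (b : HilbertBasis ι ℂ H) (x : H) :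
    ∑' i, ENNReal.ofReal (‖(inner ℂ (b i) x : ℂ)‖ ^ 2) = ENNReal.ofReal (‖x‖ ^ 2) := by
  have h : HasSum (fun i => ‖(inner ℂ (b i) x : ℂ)‖ ^ 2) (‖x‖ ^ 2) := by
    have h1 := Complex.hasSum_re (b.hasSum_inner_mul_inner x x)
    rw [inner_self_eq_norm_sq_to_K] at h1
    convert h1 using 1
    · ext i
      rw [← inner_conj_symm x (b i), mul_comm, Complex.mul_conj, Complex.normSq_eq_norm_sq,
        Complex.ofReal_re]
    · norm_cast
  rw [← ENNReal.ofReal_tsum_of_nonneg (fun _ => by positivity) h.summable, h.tsum_eq]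

/-- The squared Hilbert–Schmidt norm. -/
def hsSq (S : H →L[ℂ] H) : ℝ≥0∞ := ∑' i, ENNReal.ofReal (‖S (stdBasis H i)‖ ^ 2)

lemma hsSq_adjoint (S : H →L[ℂ] H) : hsSq (star S) = hsSq S := by
  unfold hsSq
  simp_rw [← parseval (stdBasis H)]
  rw [ENNReal.tsum_comm]
  refine tsum_congr fun i => tsum_congr fun j => ?_
  rw [ContinuousLinearMap.star_eq_adjoint, ContinuousLinearMap.adjoint_inner_right,
    ← inner_conj_symm, RCLike.norm_conj]

lemma hsSq_mul_le (X S : H →L[ℂ] H) (hX : ‖X‖ ≤ 1) : hsSq (X * S) ≤ hsSq S := by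
  refine ENNReal.tsum_le_tsum fun i => ENNReal.ofReal_le_ofReal ?_
  have := X.le_of_opNorm_le hX (S (stdBasis H i))
  rw [one_mul] at this
  exact pow_le_pow_left₀ (norm_nonneg _) this 2

lemma posTrace_star_mul_self (S : H →L[ℂ] H) : posTrace (star S * S) = hsSq S := by
  refine tsum_congr fun i => ?_
  rw [mul_apply_eq_comp, ContinuousLinearMap.star_eq_adjoint,
    ContinuousLinearMap.adjoint_inner_right, inner_self_eq_norm_sq_to_K]
  norm_cast

/-- Douglas factorization. -/
lemma exists_factor (S T : H →L[ℂ] H) (h : ∀ x, ‖S x‖ ≤ ‖T x‖) :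
    ∃ W : H →L[ℂ] H, ‖W‖ ≤ 1 ∧ S = W * T := by
  set K := (LinearMap.range (T : H →ₗ[ℂ] H)).topologicalClosure with hK
  have hmem : ∀ x, (T : H →ₗ[ℂ] H) x ∈ K := fun x =>
    Submodule.le_topologicalClosure _ (LinearMap.mem_range_self _ x)
  let e : H →ₗ[ℂ] K := LinearMap.codRestrict K (T : H →ₗ[ℂ] H) hmem
  have he : DenseRange e := by
    intro y
    rw [closure_subtype]
    have hy : (y : H) ∈ closure (Set.range T) := y.2
    convert! hy using 2
    ext z
    constructor
    · rintro ⟨_, ⟨x, rfl⟩, rfl⟩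
      exact ⟨x, rfl⟩
    · rintro ⟨x, rfl⟩
      exact ⟨e x, ⟨x, rfl⟩, rfl⟩
  have hb : ∀ x, ‖(S : H →ₗ[ℂ] H) x‖ ≤ 1 * ‖e x‖ := fun x => by
    rw [one_mul]; exact h x
  have : CompleteSpace K := (Submodule.isClosed_topologicalClosure _).completeSpace_coe
  refine ⟨(LinearMap.extendOfNorm (S : H →ₗ[ℂ] H) e) ∘L K.orthogonalProjectionOnto, ?_, ?_⟩
  · refine (ContinuousLinearMap.opNorm_comp_le _ _).trans (mul_le_one₀ ?_ (norm_nonneg _) ?_)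
    · exact LinearMap.opNorm_extendOfNorm_le he zero_le_one hb
    · exact K.orthogonalProjectionOnto_norm_le
  · ext x
    have h1 : K.orthogonalProjectionOnto (T x) = e x :=
      Submodule.orthogonalProjectionOnto_mem_subspace_eq_self (e x)
    change S x = LinearMap.extendOfNorm (S : H →ₗ[ℂ] H) e (K.orthogonalProjectionOnto (T x))
    rw [h1, LinearMap.extendOfNorm_eq he ⟨1, hb⟩]
    rfl

lemma norm_abs_apply (T : H →L[ℂ] H) (x : H) : ‖CFC.abs T x‖ = ‖T x‖ := by
  have h : ∀ S : H →L[ℂ] H, ((‖S x‖ ^ 2 : ℝ) : ℂ) = inner ℂ x ((star S * S) x) := fun S => by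
    rw [mul_apply_eq_comp, ContinuousLinearMap.star_eq_adjoint,
      ContinuousLinearMap.adjoint_inner_right, inner_self_eq_norm_sq_to_K]
    norm_cast
  have h2 : ((‖CFC.abs T x‖ ^ 2 : ℝ) : ℂ) = ((‖T x‖ ^ 2 : ℝ) : ℂ) := by
    rw [h, h, (CFC.abs_nonneg T).isSelfAdjoint.star_eq, CFC.abs_mul_abs]
  exact (pow_left_inj₀ (norm_nonneg _) (norm_nonneg _) two_ne_zero).1 (by exact_mod_cast h2)

lemma tsum_inner_le (X T : H →L[ℂ] H) (hX : ‖X‖ ≤ 1) :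
    ∑' i, ENNReal.ofReal ‖(inner ℂ (stdBasis H i) ((X * T) (stdBasis H i)) : ℂ)‖ ≤
      traceNorm T := by
  obtain ⟨V, hV, hTV⟩ := exists_factor T (CFC.abs T) fun x => (norm_abs_apply T x).ge
  set S := CFC.sqrt (CFC.abs T) with hS
  have hSs : star S = S := (CFC.sqrt_nonneg _).isSelfAdjoint.star_eq
  have hSS : star S * S = CFC.abs T := by
    rw [hSs]; exact CFC.sqrt_mul_sqrt_self _ (CFC.abs_nonneg T)
  have hY : ‖X * V‖ ≤ 1 := (norm_mul_le _ _).trans (mul_le_one₀ hX (norm_nonneg _) hV)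
  set Y := X * V
  have hXT : X * T = star (S * star Y) * S := by
    rw [star_mul, star_star, mul_assoc, hSS, mul_assoc, ← hTV]
  have key : ∀ x, ‖(inner ℂ x ((X * T) x) : ℂ)‖ ≤ (‖(S * star Y) x‖ ^ 2 + ‖S x‖ ^ 2) / 2 := by
    intro x
    rw [hXT, mul_apply_eq_comp]
    generalize S * star Y = Z
    rw [ContinuousLinearMap.star_eq_adjoint, ContinuousLinearMap.adjoint_inner_right]
    have := norm_inner_le_norm (𝕜 := ℂ) (Z x) (S x)
    nlinarith [sq_nonneg (‖Z x‖ - ‖S x‖)]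
  have h1 : hsSq (S * star Y) ≤ hsSq S := by
    rw [← hsSq_adjoint, star_mul, star_star, hSs]
    exact hsSq_mul_le _ _ hY
  calc _ ≤ ∑' i, (ENNReal.ofReal (‖(S * star Y) (stdBasis H i)‖ ^ 2) +
          ENNReal.ofReal (‖S (stdBasis H i)‖ ^ 2)) / 2 := by
        refine ENNReal.tsum_le_tsum fun i => (ENNReal.ofReal_le_ofReal (key _)).trans ?_
        rw [ENNReal.ofReal_div_of_pos two_pos, ENNReal.ofReal_add (by positivity) (by positivity)]
        simp
    _ = (hsSq (S * star Y) + hsSq S) / 2 := by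
        simp_rw [div_eq_mul_inv]
        rw [ENNReal.tsum_mul_right, ENNReal.tsum_add]; rfl
    _ ≤ (hsSq S + hsSq S) / 2 := by gcongr
    _ = traceNorm T := by
        rw [ENNReal.add_div, ENNReal.add_halves, traceNorm, ← hSS, posTrace_star_mul_self]

lemma traceNorm_add_le (T₁ T₂ : H →L[ℂ] H) :
    traceNorm (T₁ + T₂) ≤ traceNorm T₁ + traceNorm T₂ := by
  obtain ⟨W, hW, h⟩ := exists_factor (CFC.abs (T₁ + T₂)) (T₁ + T₂)
    fun x => (norm_abs_apply _ x).le
  refine le_trans ?_ (add_le_add (tsum_inner_le W T₁ hW) (tsum_inner_le W T₂ hW))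
  rw [← ENNReal.tsum_add, traceNorm, posTrace, h]
  refine ENNReal.tsum_le_tsum fun i => ?_
  rw [← ENNReal.ofReal_add (norm_nonneg _) (norm_nonneg _), mul_add,
    add_apply, inner_add_right]
  exact ENNReal.ofReal_le_ofReal ((Complex.re_le_norm _).trans (norm_add_le _ _))

variable (H) in
/-- The space `𝒯(H)` of trace-class operators. -/
def traceClass : Submodule ℂ (H →L[ℂ] H) where
  carrier := {T | traceNorm T < ∞}
  add_mem' h₁ h₂ := (traceNorm_add_le _ _).trans_lt (ENNReal.add_lt_top.2 ⟨h₁, h₂⟩)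
  zero_mem' := by simp [traceNorm, posTrace]
  smul_mem' c T h := by
    have h' : traceNorm (c • T) = ENNReal.ofReal ‖c‖ * traceNorm T := by
      rw [traceNorm, traceNorm, CFC.abs_smul, posTrace, posTrace, ← ENNReal.tsum_mul_left]
      refine tsum_congr fun i => ?_
      rw [← ENNReal.ofReal_mul (norm_nonneg _), smul_apply,
        RCLike.real_smul_eq_coe_smul (K := ℂ), inner_smul_right]
      congr 1
      exact Complex.re_ofReal_mul _ _
    rw [Set.mem_ofPred_eq, h']
    exact ENNReal.mul_lt_top ENNReal.ofReal_lt_top h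

/-- Density operators (states): positive trace-class operators with trace one. -/
def IsDensity (ρ : traceClass H) : Prop :=
  (ρ : H →L[ℂ] H).IsPositive ∧ trace (ρ : H →L[ℂ] H) = 1

/-- The quantum entropy `H(ρ) = Tr η(ρ) ∈ [0, ∞]`, with `η(x) = -x log₂ x` and `η(0) = 0`. -/
def entropy (ρ : H →L[ℂ] H) : ℝ≥0∞ :=
  posTrace (cfc (fun x : ℝ => -x * Real.logb 2 x) ρ)

end TraceClass

section Channel

variable (A B E : Type*)
  [NormedAddCommGroup A] [InnerProductSpace ℂ A] [CompleteSpace A]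
  [NormedAddCommGroup B] [InnerProductSpace ℂ B] [CompleteSpace B]
  [NormedAddCommGroup E] [InnerProductSpace ℂ E] [CompleteSpace E]

/-- A quantum channel: a completely positive, trace-preserving linear map `𝒯(A) → 𝒯(B)`.
Complete positivity says that for each `k` the map `id ⊗ N` sends positive `k × k` block operators
to positive ones. -/
structure QuantumChannel extends traceClass A →ₗ[ℂ] traceClass B where
  completelyPositive : ∀ (k : ℕ) (τ : Fin k → Fin k → traceClass A),
    (∀ x : Fin k → A, 0 ≤ ∑ i, ∑ j, inner ℂ (x i) ((τ i j : A →L[ℂ] A) (x j))) →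
    ∀ y : Fin k → B, 0 ≤ ∑ i, ∑ j, inner ℂ (y i) ((toFun (τ i j) : B →L[ℂ] B) (y j))
  tracePreserving : ∀ τ : traceClass A,
    trace (toFun τ : B →L[ℂ] B) = trace (τ : A →L[ℂ] A)

/-- The Hilbert space tensor product. -/
abbrev HTensor : Type _ := UniformSpace.Completion (B ⊗[ℂ] E)

variable {A B E}

/-- `φ ↦ φ ⊗ e`. -/
def tensorRight (e : E) : B →L[ℂ] HTensor B E :=
  (UniformSpace.Completion.toComplL : B ⊗[ℂ] E →L[ℂ] HTensor B E) ∘L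
    (TensorProduct.mkL ℂ B E).flip e

/-- `φ ↦ b ⊗ φ`. -/
def tensorLeft (b : B) : E →L[ℂ] HTensor B E :=
  (UniformSpace.Completion.toComplL : B ⊗[ℂ] E →L[ℂ] HTensor B E) ∘L TensorProduct.mkL ℂ B E b

/-- The partial trace `Tr_E X = ∑ₗ (I ⊗ ⟨l|) X (I ⊗ |l⟩)` of a trace-class operator `X`
on `B ⊗ E`; the series converges absolutely in norm. -/
def partialTraceE (X : HTensor B E →L[ℂ] HTensor B E) : B →L[ℂ] B :=
  ∑' l, (tensorRight (stdBasis E l)).adjoint ∘L X ∘L tensorRight (stdBasis E l)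

/-- The partial trace `Tr_B X` of a trace-class operator `X` on `B ⊗ E`. -/
def partialTraceB (X : HTensor B E →L[ℂ] HTensor B E) : E →L[ℂ] E :=
  ∑' l, (tensorLeft (stdBasis B l)).adjoint ∘L X ∘L tensorLeft (stdBasis B l)

/-- `Nc : 𝒯(A) → 𝒯(E)` is complementary to `N : 𝒯(A) → 𝒯(B)`: for some isometry `U : A → B ⊗ E`,
`N τ = Tr_E (U τ U†)` and `Nc τ = Tr_B (U τ U†)`. -/
def IsComplementary (N : traceClass A →ₗ[ℂ] traceClass B)
    (Nc : traceClass A →ₗ[ℂ] traceClass E) : Prop :=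
  ∃ U : A →ₗᵢ[ℂ] HTensor B E, ∀ τ : traceClass A,
    (N τ : B →L[ℂ] B) = partialTraceE
      (U.toContinuousLinearMap ∘L (τ : A →L[ℂ] A) ∘L U.toContinuousLinearMap.adjoint) ∧
    (Nc τ : E →L[ℂ] E) = partialTraceB
      (U.toContinuousLinearMap ∘L (τ : A →L[ℂ] A) ∘L U.toContinuousLinearMap.adjoint)

end Channel

section Energy

variable {A B ι : Type*}
  [NormedAddCommGroup A] [InnerProductSpace ℂ A] [CompleteSpace A]
  [NormedAddCommGroup B] [InnerProductSpace ℂ B] [CompleteSpace B]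

/-- Multiplication by a bounded family on `ℓ²`. -/
def diagL2 (f : ι → ℝ) (C : ℝ) (hf : ∀ i, |f i| ≤ C) :
    lp (fun _ : ι => ℂ) 2 →L[ℂ] lp (fun _ : ι => ℂ) 2 :=
  have hx : ∀ (x : lp (fun _ : ι => ℂ) 2) i, ‖(f i : ℂ) * x i‖ ≤ ‖((C : ℂ) • x) i‖ := fun x i => by
    rw [lp.coeFn_smul, Pi.smul_apply, norm_smul, norm_mul, Complex.norm_real, Complex.norm_real]
    exact mul_le_mul_of_nonneg_right ((hf i).trans (le_abs_self C)) (norm_nonneg _)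
  LinearMap.mkContinuous
    { toFun := fun x => ⟨fun i => (f i : ℂ) * x i, (lp.memℓp ((C : ℂ) • x)).mono' (hx x)⟩
      map_add' := fun x y => by ext i; exact mul_add _ _ _
      map_smul' := fun c x => by ext i; exact mul_left_comm _ _ _ }
    |C| fun x => by
      refine (lp.norm_mono two_ne_zero (hx x)).trans ?_
      rw [norm_smul, Complex.norm_real, Real.norm_eq_abs]

/-- The bounded diagonal operator `∑ᵢ fᵢ |eᵢ⟩⟨eᵢ|`. -/
def diagOp (b : HilbertBasis ι ℂ A) (f : ι → ℝ) (hf : ∃ C, ∀ i, |f i| ≤ C) : A →L[ℂ] A :=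
  b.repr.symm.toContinuousLinearEquiv.toContinuousLinearMap ∘L
    diagL2 f hf.choose hf.choose_spec ∘L b.repr.toContinuousLinearEquiv.toContinuousLinearMap

variable (A ι) in
/-- An energy observable `G = ∑ⱼ gⱼ |eⱼ⟩⟨eⱼ|` (in general unbounded), given by an orthonormal basis
of eigenvectors and the non-negative eigenvalues. -/
structure EnergyObservable where
  basis : HilbertBasis ι ℂ A
  energy : ι → ℝ
  energy_nonneg : ∀ j, 0 ≤ energy j

namespace EnergyObservable

variable (G : EnergyObservable A ι)

/-- The bounded operator `Πₙ G Πₙ`, where `Πₙ` is the spectral projection of `G` for `[0, n]`. -/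
def truncation (n : ℕ) : A →L[ℂ] A :=
  diagOp G.basis (fun j => if G.energy j ≤ n then G.energy j else 0) ⟨n, fun j => by
    split_ifs with h
    · rwa [abs_of_nonneg (G.energy_nonneg j)]
    · simp⟩

/-- `Tr (G ρ) = supₙ Tr (Πₙ G Πₙ ρ) ∈ [0, ∞]` for a positive trace-class operator `ρ`. -/
def mean (ρ : A →L[ℂ] A) : ℝ≥0∞ := ⨆ n : ℕ, ENNReal.ofReal (trace (G.truncation n * ρ)).re

/-- The operator `exp (-β G)` for `β > 0`. -/
def boltzmann (β : ℝ) (hβ : 0 < β) : A →L[ℂ] A :=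
  diagOp G.basis (fun j => Real.exp (-β * G.energy j)) ⟨1, fun j => by
    rw [Real.abs_exp, Real.exp_le_one_iff]
    nlinarith [mul_nonneg hβ.le (G.energy_nonneg j)]⟩

/-- `G` is a Gibbs observable if `Tr exp (-β G) < ∞` for all `β > 0`. -/
def IsGibbs : Prop := ∀ (β : ℝ) (hβ : 0 < β), posTrace (G.boltzmann β hβ) < ∞

end EnergyObservable

/-- The finite-output-entropy condition: `sup {H(N(ρ)) : ρ a state, Tr (G ρ) ≤ P} < ∞`. -/
def FiniteOutputEntropy (N : traceClass A →ₗ[ℂ] traceClass B) (G : EnergyObservable A ι)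
    (P : ℝ≥0) : Prop :=
  ⨆ (ρ : traceClass A) (_ : IsDensity ρ) (_ : G.mean ρ ≤ P), entropy (N ρ : B →L[ℂ] B) < ∞

end Energy

end QInfo

end

namespace QInfo

open Module.End

universe u

/-! The state `U ρ U†` on `B ⊗ E` is purified by a copy of `A`, so morally `H(E) = H(AB) ≤ H(A) +
H(B)`. Here `H(B)` is bounded by hypothesis, and the energy bound controls `H(A)` by Gibbs'
variational principle. The proof fuses both inequalities into one classical estimate.

With `Q = √ρ U†`, so that `Q† Q = U ρ U†`, let `c`, `b` be eigenbases of the marginals on `E`, `B`,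
with eigenvalues `ε`, `β`, and `g` the energy basis. Put `w(e,j,l) = |⟨g_j, Q (b_l ⊗ c_e)⟩|²`. Its
marginals in `e` and `l` are `ε` and `β`; the one in `j` is at most `⟨g_j, ρ g_j⟩`. The quantum
input is `∑ₑ w(e,j,l)/ε_e ≤ 1` for all `j`, `l` (`tsum_norm_inner_sq_div_le_one`): the `E`-marginal
dominates a rank-one operator `|v⟩⟨v|` for each pair `(j,l)`.

Summing `w` times `log x ≤ x - 1` at `x = exp(-h_j) β_l / ε_e` gives `H(ε) ≤ ∑ⱼ ⟨g_j, ρ g_j⟩ h_j +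
H(β)` in nats, whenever `∑ⱼ exp(-h_j) ≤ 1` (`tsum_negMulLog_le`, `entropy_partialTraceB_le`).
Choosing `h` as the energy plus a normalizing constant, the first sum is at most `P` plus that
constant. Sums are taken in `[0, ∞]`, so interchanging them is free; boundedness enters only to
cancel the total mass of `w`. -/

lemma bessel {F ι : Type*} [NormedAddCommGroup F] [InnerProductSpace ℂ F] {v : ι → F}
    (hv : Orthonormal ℂ v)
    (x : F) :
    ∑' i, ENNReal.ofReal (‖(inner ℂ (v i) x : ℂ)‖ ^ 2) ≤ ENNReal.ofReal (‖x‖ ^ 2) := by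
  rw [← ENNReal.ofReal_tsum_of_nonneg (fun _ => by positivity) (hv.inner_products_summable x)]
  exact ENNReal.ofReal_le_ofReal (hv.tsum_inner_products_le x)

/-! ### Hilbert–Schmidt sums, eigenbases of positive trace-class operators, functional calculus on
eigenvectors. -/

section HilbertSchmidt

variable {H K ι κ : Type*} [NormedAddCommGroup H] [InnerProductSpace ℂ H] [CompleteSpace H]
  [NormedAddCommGroup K] [InnerProductSpace ℂ K] [CompleteSpace K]

lemma tsum_norm_sq_adjoint (b : HilbertBasis ι ℂ H) (c : HilbertBasis κ ℂ K) (S : H →L[ℂ] K) :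
    ∑' i, ENNReal.ofReal (‖S (b i)‖ ^ 2) = ∑' j, ENNReal.ofReal (‖S.adjoint (c j)‖ ^ 2) := by
  simp_rw [← parseval c (S _), ← parseval b (S.adjoint _)]
  rw [ENNReal.tsum_comm]
  refine tsum_congr fun j => tsum_congr fun i => ?_
  rw [ContinuousLinearMap.adjoint_inner_right, ← inner_conj_symm, RCLike.norm_conj]

lemma tsum_norm_sq_eq_hsSq (b : HilbertBasis ι ℂ H) (S : H →L[ℂ] H) :
    ∑' i, ENNReal.ofReal (‖S (b i)‖ ^ 2) = hsSq S := by
  rw [tsum_norm_sq_adjoint b (stdBasis H), tsum_norm_sq_adjoint (stdBasis H) (stdBasis H),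
    ContinuousLinearMap.adjoint_adjoint, hsSq]

/-- Parseval for `S† y` in the basis `b`, with Cauchy–Schwarz on each coefficient `⟨S (b i), y⟩`,
bounds `‖S†‖ = ‖S‖`. -/
lemma ofReal_opNorm_sq_le (b : HilbertBasis ι ℂ H) (S : H →L[ℂ] K) :
    ENNReal.ofReal (‖S‖ ^ 2) ≤ ∑' i, ENNReal.ofReal (‖S (b i)‖ ^ 2) := by
  rcases eq_or_ne (∑' i, ENNReal.ofReal (‖S (b i)‖ ^ 2)) ∞ with h | h
  · exact h ▸ le_top
  refine ENNReal.ofReal_le_of_le_toReal ?_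
  set c := (∑' i, ENNReal.ofReal (‖S (b i)‖ ^ 2)).toReal with hc
  have hc0 : 0 ≤ c := ENNReal.toReal_nonneg
  have key : ‖S.adjoint‖ ≤ √c := by
    refine ContinuousLinearMap.opNorm_le_bound _ (Real.sqrt_nonneg _) fun y => ?_
    refine abs_le_of_sq_le_sq' ?_ (by positivity) |>.2
    rw [mul_pow, Real.sq_sqrt hc0]
    have h1 : ENNReal.ofReal (‖S.adjoint y‖ ^ 2) ≤ ENNReal.ofReal (c * ‖y‖ ^ 2) := by
      rw [← parseval b, ENNReal.ofReal_mul hc0, hc, ENNReal.ofReal_toReal h,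
        ← ENNReal.tsum_mul_right]
      refine ENNReal.tsum_le_tsum fun i => ?_
      rw [← ENNReal.ofReal_mul (by positivity), ContinuousLinearMap.adjoint_inner_right]
      refine ENNReal.ofReal_le_ofReal ?_
      rw [← mul_pow]
      gcongr
      exact norm_inner_le_norm _ _
    exact (ENNReal.ofReal_le_ofReal_iff (by positivity)).1 h1
  rw [LinearIsometryEquiv.norm_map] at key
  calc ‖S‖ ^ 2 ≤ √c ^ 2 := by gcongr
    _ = c := Real.sq_sqrt hc0

/-- The finite-rank operators `F s` agree with `S` on `b i` for `i ∈ s` and kill the other basis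
vectors, so `‖F s - S‖²` is at most a tail of the convergent sum. -/
lemma isCompactOperator_of_tsum_norm_sq_lt_top (b : HilbertBasis ι ℂ H) (S : H →L[ℂ] K)
    (hS : ∑' i, ENNReal.ofReal (‖S (b i)‖ ^ 2) < ∞) : IsCompactOperator S := by
  classical
  let F : Finset ι → H →L[ℂ] K := fun s =>
    ∑ i ∈ s, (innerSL ℂ (b i)).smulRight (S (b i))
  have hF : ∀ s, IsCompactOperator (F s) := fun s => by
    refine Submodule.sum_mem (compactOperator (RingHom.id ℂ) H K) fun i _ => ?_
    exact (isCompactOperator_of_locallyCompactSpace_dom (innerSL ℂ (b i))).clm_comp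
      (ContinuousLinearMap.toSpanSingleton ℂ (S (b i)))
  have hFb : ∀ s i, F s (b i) = if i ∈ s then S (b i) else 0 := fun s i => by
    simp only [F, sum_apply, ContinuousLinearMap.smulRight_apply,
      innerSL_apply_apply, orthonormal_iff_ite.1 b.orthonormal, ite_smul, one_smul, zero_smul]
    simp
  have hle : ∀ s : Finset ι, ENNReal.ofReal (‖F s - S‖ ^ 2) ≤
      ∑' i : {i // i ∉ s}, ENNReal.ofReal (‖S (b i)‖ ^ 2) := fun s => by
    refine (ofReal_opNorm_sq_le b _).trans_eq ?_
    rw [show (∑' i : {i // i ∉ s}, ENNReal.ofReal (‖S (b i)‖ ^ 2)) =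
      ∑' i : ({i | i ∉ s} : Set ι), ENNReal.ofReal (‖S (b i)‖ ^ 2) from rfl,
      tsum_subtype {i | i ∉ s} fun i => ENNReal.ofReal (‖S (b i)‖ ^ 2)]
    refine tsum_congr fun i => ?_
    rw [sub_apply, hFb]
    by_cases h : i ∈ s <;> simp [h]
  have h0 : Filter.Tendsto (fun s => ENNReal.ofReal (‖F s - S‖ ^ 2)) Filter.atTop (nhds 0) :=
    tendsto_of_tendsto_of_tendsto_of_le_of_le tendsto_const_nhds
      (ENNReal.tendsto_tsum_compl_atTop_zero hS.ne) (fun _ => zero_le) hle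
  refine isCompactOperator_of_tendsto (F := F) (l := Filter.atTop) ?_ (.of_forall hF)
  rw [tendsto_iff_norm_sub_tendsto_zero]
  have h1 := (ENNReal.tendsto_toReal ENNReal.zero_ne_top).comp h0
  have h2 := (Real.continuous_sqrt.tendsto _).comp h1
  refine Filter.Tendsto.congr (fun s => ?_) (by rwa [ENNReal.toReal_zero, Real.sqrt_zero] at h2)
  simp only [Function.comp_apply]
  rw [ENNReal.toReal_ofReal (by positivity), Real.sqrt_sq (norm_nonneg _)]

lemma posTrace_eq_hsSq_sqrt {T : H →L[ℂ] H} (hT : 0 ≤ T) : posTrace T = hsSq (CFC.sqrt T) := by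
  rw [← posTrace_star_mul_self, (CFC.sqrt_nonneg T).isSelfAdjoint.star_eq,
    CFC.sqrt_mul_sqrt_self T hT]

lemma inner_apply_eq_norm_sqrt_sq {T : H →L[ℂ] H} (hT : 0 ≤ T) (x : H) :
    inner ℂ x (T x) = ((‖CFC.sqrt T x‖ ^ 2 : ℝ) : ℂ) := by
  conv_lhs => rw [← CFC.sqrt_mul_sqrt_self T hT]
  rw [mul_apply_eq_comp, ← ContinuousLinearMap.adjoint_inner_left,
    ← ContinuousLinearMap.star_eq_adjoint, (CFC.sqrt_nonneg T).isSelfAdjoint.star_eq,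
    inner_self_eq_norm_sq_to_K]
  norm_cast

lemma posTrace_eq_tsum (b : HilbertBasis ι ℂ H) {T : H →L[ℂ] H} (hT : 0 ≤ T) :
    posTrace T = ∑' i, ENNReal.ofReal (inner ℂ (b i) (T (b i))).re := by
  rw [posTrace_eq_hsSq_sqrt hT, ← tsum_norm_sq_eq_hsSq b]
  refine tsum_congr fun i => ?_
  rw [inner_apply_eq_norm_sqrt_sq hT, Complex.ofReal_re]

lemma isCompactOperator_of_posTrace_lt_top {T : H →L[ℂ] H} (hT : 0 ≤ T) (htr : posTrace T < ∞) :
    IsCompactOperator T := by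
  have h1 : IsCompactOperator (CFC.sqrt T : H →L[ℂ] H) :=
    isCompactOperator_of_tsum_norm_sq_lt_top (stdBasis H) _
      (by rwa [posTrace_eq_hsSq_sqrt hT] at htr)
  have h2 : T = (CFC.sqrt T : H →L[ℂ] H) ∘L (CFC.sqrt T : H →L[ℂ] H) :=
    (CFC.sqrt_mul_sqrt_self T hT).symm
  rw [h2]
  exact h1.clm_comp (CFC.sqrt T : H →L[ℂ] H)

/-- A positive trace-class operator is diagonal in some orthonormal basis. -/
lemma exists_eigenbasis {H : Type u} [NormedAddCommGroup H] [InnerProductSpace ℂ H]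
    [CompleteSpace H] {T : H →L[ℂ] H} (hT : 0 ≤ T) (htr : posTrace T < ∞) :
    ∃ (s : Type u) (b : HilbertBasis s ℂ H) (μ : s → ℝ), ∀ i, T (b i) = (μ i : ℂ) • b i := by
  have hsym : (T : H →ₗ[ℂ] H).IsSymmetric :=
    ((ContinuousLinearMap.nonneg_iff_isPositive T).1 hT).isSymmetric
  have hcomp := isCompactOperator_of_posTrace_lt_top hT htr
  have hbot := ContinuousLinearMap.orthogonalComplement_iSup_eigenspaces_eq_bot hcomp hsym
  let V : ℂ → Submodule ℂ H := fun μ => eigenspace (T : H →ₗ[ℂ] H) μ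
  have hV : ∀ μ, IsClosed (V μ : Set H) := fun μ => by
    have : (V μ : Set H) = {x | T x = μ • x} := by ext x; simp [V]
    rw [this]
    exact isClosed_eq T.continuous (continuous_const_smul μ)
  have hcompl : ∀ μ, CompleteSpace (V μ) := fun μ => (hV μ).completeSpace_coe
  -- The index runs over all complex `μ`, including `0`, so a basis of the kernel is part of the
  -- family; a `μ` that is not an eigenvalue contributes no vectors.
  let v : (Σ μ : ℂ, stdIndex (V μ)) → H := fun a => (stdBasis (V a.1) a.2 : V a.1)
  have hon : Orthonormal ℂ v := hsym.orthogonalFamily_eigenspaces.orthonormal_sigma_orthonormal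
    (v_family := fun μ i => stdBasis (V μ) i) fun μ => (stdBasis (V μ)).orthonormal
  have hspan : (Submodule.span ℂ (Set.range v))ᗮ = ⊥ := by
    rw [eq_bot_iff, ← hbot]
    intro x hx
    rw [Submodule.mem_orthogonal'] at hx ⊢
    suffices h : (⨆ μ, V μ) ≤ (ℂ ∙ x)ᗮ from fun u hu => by
      simpa using Submodule.mem_orthogonal_singleton_iff_inner_right.1 (h hu)
    refine iSup_le fun μ u hu => ?_
    rw [Submodule.mem_orthogonal_singleton_iff_inner_right]
    have h2 := ((stdBasis (V μ)).hasSum_repr ⟨u, hu⟩).mapL (V μ).subtypeL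
    have h3 := h2.mapL (innerSL ℂ x)
    refine h3.unique ?_
    convert hasSum_zero with i
    have := hx (v ⟨μ, i⟩) (Submodule.subset_span ⟨_, rfl⟩)
    simp only [v] at this
    simp [this]
  refine ⟨_, HilbertBasis.mkOfOrthogonalEqBot hon hspan, fun a => a.1.re, fun a => ?_⟩
  rw [HilbertBasis.coe_mkOfOrthogonalEqBot]
  have hv : T (v a) = a.1 • v a := mem_eigenspace_iff.1 (stdBasis (V a.1) a.2).2
  have hreal : (a.1.re : ℂ) = a.1 := by
    have h0 : v a ≠ 0 := hon.ne_zero a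
    exact Complex.conj_eq_iff_re.1 (hsym.conj_eigenvalue_eq_self
      (hasEigenvalue_of_hasEigenvector ⟨mem_eigenspace_iff.2 hv, h0⟩))
  rw [hreal, hv]

/-- Stone–Weierstrass on the spectrum: the identity holds for constants and for the coordinate
function, and survives sums, products and uniform limits. -/
lemma cfc_apply_eigenvector {T : H →L[ℂ] H} (hT : IsSelfAdjoint T) {f : ℝ → ℝ}
    (hf : Continuous f) {x : H} {μ : ℝ} (hx : x ≠ 0) (h : T x = (μ : ℂ) • x) :
    cfc f T x = (f μ : ℂ) • x := by
  have hμ : μ ∈ spectrum ℝ T := by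
    rw [spectrum.mem_iff]
    intro hu
    have h0 : (algebraMap ℝ (H →L[ℂ] H) μ - T) x = 0 := by
      rw [sub_apply, h, Algebra.algebraMap_eq_smul_one, smul_apply]
      simp
    obtain ⟨u, hu⟩ := hu
    apply hx
    have : ((↑u⁻¹ : H →L[ℂ] H) * ↑u) x = 0 := by
      rw [mul_apply_eq_comp, hu, h0, map_zero]
    simpa using this
  rw [cfc_apply f T hT hf.continuousOn]
  have key : ∀ g : C(spectrum ℝ T, ℝ), cfcHom hT g x = (g ⟨μ, hμ⟩ : ℂ) • x := by
    intro g
    have hid : cfcHom hT (.restrict (spectrum ℝ T) (.id ℝ)) x = (μ : ℂ) • x := by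
      rw [cfcHom_id hT, h]
    induction g using ContinuousMap.induction_on_of_compact with
    | const r =>
      have : ContinuousMap.const (spectrum ℝ T) r = algebraMap ℝ C(spectrum ℝ T, ℝ) r := rfl
      rw [this, AlgHomClass.commutes, Algebra.algebraMap_eq_smul_one, smul_apply]
      simp
    | id => exact hid
    | star_id => exact hid
    | add f g hf hg => rw [map_add, add_apply, hf, hg, ← add_smul]; simp
    | mul f g hf hg =>
      rw [map_mul, mul_apply_eq_comp, hg, map_smul, hf, smul_smul, mul_comm]; simp
    | frequently f hf =>
      have hc : IsClosed {g : C(spectrum ℝ T, ℝ) | cfcHom hT g x = (g ⟨μ, hμ⟩ : ℂ) • x} := by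
        refine isClosed_eq ?_ ?_
        · exact (ContinuousLinearMap.apply ℂ H x).continuous.comp (cfcHom_continuous hT)
        · exact (Complex.continuous_ofReal.comp (continuous_eval_const _)).smul continuous_const
      exact hc.mem_of_frequently_of_tendsto hf Filter.tendsto_id
  exact key _

lemma posTrace_of_diag (b : HilbertBasis ι ℂ H) {T : H →L[ℂ] H} {μ : ι → ℝ} (hμ : ∀ i, 0 ≤ μ i)
    (h : ∀ i, T (b i) = (μ i : ℂ) • b i) : posTrace T = ∑' i, ENNReal.ofReal (μ i) := by
  have hx : ∀ x, HasSum (fun i => μ i * ‖(inner ℂ (b i) x : ℂ)‖ ^ 2) (inner ℂ x (T x)).re := by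
    intro x
    have h1 := ((b.hasSum_repr x).mapL T).mapL (innerSL ℂ x)
    have h2 := Complex.hasSum_re h1
    rw [innerSL_apply_apply] at h2
    convert h2 using 1
    ext i
    simp only [innerSL_apply_apply, map_smul, h, b.repr_apply_apply, smul_eq_mul]
    rw [← inner_conj_symm x (b i), mul_left_comm, Complex.mul_conj, Complex.normSq_eq_norm_sq]
    norm_cast
  have hx' : ∀ x, ENNReal.ofReal (inner ℂ x (T x)).re =
      ∑' i, ENNReal.ofReal (μ i) * ENNReal.ofReal (‖(inner ℂ (b i) x : ℂ)‖ ^ 2) := by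
    intro x
    rw [← (hx x).tsum_eq, ENNReal.ofReal_tsum_of_nonneg
      (fun i => mul_nonneg (hμ i) (by positivity)) (hx x).summable]
    exact tsum_congr fun i => ENNReal.ofReal_mul (hμ i)
  unfold posTrace
  simp_rw [hx']
  rw [ENNReal.tsum_comm]
  refine tsum_congr fun i => ?_
  rw [ENNReal.tsum_mul_left]
  simp_rw [← inner_conj_symm (b i), RCLike.norm_conj]
  rw [parseval, b.orthonormal.1]
  simp

end HilbertSchmidt

/-! ### The classical Gibbs inequality for three variables. -/

section GibbsInequality

variable {κ ι ν : Type*}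

/-- This is `w` times `log x ≤ x - 1` at `x = exp(-h) β / ε`, rearranged without subtraction so that
it can be summed in `[0, ∞]`. Clipping `h` or `-log β` at zero only enlarges the right side. -/
lemma mul_neg_log_add_le {w ε β h : ℝ} (hw : 0 ≤ w) (hwε : w ≤ ε) (hwβ : w ≤ β) (hε : ε ≤ 1) :
    ENNReal.ofReal w * ENNReal.ofReal (-Real.log ε) + ENNReal.ofReal w ≤
      ENNReal.ofReal w * ENNReal.ofReal h + ENNReal.ofReal w * ENNReal.ofReal (-Real.log β) +
        ENNReal.ofReal (Real.exp (-h)) * ENNReal.ofReal β * ENNReal.ofReal (w / ε) := by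
  rcases hw.eq_or_lt with rfl | hw'
  · simp
  have hε0 := hw'.trans_le hwε
  have hβ0 := hw'.trans_le hwβ
  have hl : 0 ≤ -Real.log ε := neg_nonneg.2 (Real.log_nonpos hε0.le hε)
  rw [← ENNReal.ofReal_mul hw, ← ENNReal.ofReal_mul hw, ← ENNReal.ofReal_mul hw,
    ← ENNReal.ofReal_mul (Real.exp_pos _).le, ← ENNReal.ofReal_mul (by positivity),
    ← ENNReal.ofReal_add (by positivity) hw]
  refine le_trans (ENNReal.ofReal_le_ofReal ?_)
    (ENNReal.ofReal_add_le.trans (add_le_add_left ENNReal.ofReal_add_le _))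
  have h1 := Real.log_le_sub_one_of_pos (show 0 < Real.exp (-h) * β / ε by positivity)
  rw [Real.log_div (by positivity) hε0.ne', Real.log_mul (by positivity) hβ0.ne',
    Real.log_exp] at h1
  have h2 := mul_le_mul_of_nonneg_left h1 hw
  have h3 : w * (Real.exp (-h) * β / ε) = Real.exp (-h) * β * (w / ε) := by ring
  linarith

/-- The Gibbs inequality for a triple of random variables with joint weights `w`, in the form
`H(ε) ≤ E[h] + H(β)`. -/
lemma tsum_negMulLog_le (w : κ → ι → ν → ℝ) (hw : ∀ e j b, 0 ≤ w e j b)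
    (ε : κ → ℝ) (β : ν → ℝ) (h : ι → ℝ) (r : ι → ℝ≥0∞)
    (hε0 : ∀ e, 0 ≤ ε e) (hβ0 : ∀ b, 0 ≤ β b) (hε1 : ∀ e, ε e ≤ 1)
    (hε : ∀ e, ∑' b, ∑' j, ENNReal.ofReal (w e j b) = ENNReal.ofReal (ε e))
    (hβ : ∀ b, ∑' e, ∑' j, ENNReal.ofReal (w e j b) = ENNReal.ofReal (β b))
    (hr : ∀ j, ∑' e, ∑' b, ENNReal.ofReal (w e j b) ≤ r j) (hr' : ∑' j, r j ≠ ∞)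
    (hq : ∀ j b, ∑' e, ENNReal.ofReal (w e j b / ε e) ≤ 1)
    (hh : ∑' j, ENNReal.ofReal (Real.exp (-h j)) ≤ 1) :
    ∑' e, ENNReal.ofReal (Real.negMulLog (ε e)) ≤
      ∑' j, r j * ENNReal.ofReal (h j) + ∑' b, ENNReal.ofReal (Real.negMulLog (β b)) := by
  set W := ∑' e, ∑' b, ∑' j, ENNReal.ofReal (w e j b) with hW
  have hWj : W = ∑' j, ∑' e, ∑' b, ENNReal.ofReal (w e j b) := by
    exact (tsum_congr fun e => ENNReal.tsum_comm).trans ENNReal.tsum_comm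
  have hWb : W = ∑' b, ENNReal.ofReal (β b) := by
    rw [hW, ENNReal.tsum_comm]
    exact tsum_congr hβ
  have hWfin : W ≠ ∞ := ((hWj.trans_le (ENNReal.tsum_le_tsum hr)).trans_lt hr'.lt_top).ne
  have hwε : ∀ e j b, w e j b ≤ ε e := fun e j b =>
    (ENNReal.ofReal_le_ofReal_iff (hε0 e)).1 <| (hε e) ▸
      (ENNReal.le_tsum j).trans (ENNReal.le_tsum (f := fun b => ∑' j, ENNReal.ofReal (w e j b)) b)
  have hwβ : ∀ e j b, w e j b ≤ β b := fun e j b =>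
    (ENNReal.ofReal_le_ofReal_iff (hβ0 b)).1 <| (hβ b) ▸
      (ENNReal.le_tsum j).trans (ENNReal.le_tsum (f := fun e => ∑' j, ENNReal.ofReal (w e j b)) e)
  have hmul : ∀ x : ℝ, 0 ≤ x → ENNReal.ofReal x * ENNReal.ofReal (-Real.log x) =
      ENNReal.ofReal (Real.negMulLog x) := fun x hx => by
    rw [← ENNReal.ofReal_mul hx, Real.negMulLog, neg_mul, mul_neg]
  have key := ENNReal.tsum_le_tsum fun e => ENNReal.tsum_le_tsum fun b =>
    ENNReal.tsum_le_tsum fun j =>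
      mul_neg_log_add_le (h := h j) (hw e j b) (hwε e j b) (hwβ e j b) (hε1 e)
  simp_rw [ENNReal.tsum_add] at key
  rw [← hW] at key
  have t1 : ∑' e, ∑' b, ∑' j, ENNReal.ofReal (w e j b) * ENNReal.ofReal (-Real.log (ε e)) =
      ∑' e, ENNReal.ofReal (Real.negMulLog (ε e)) := by
    simp_rw [ENNReal.tsum_mul_right, hε]
    exact tsum_congr fun e => hmul _ (hε0 e)
  have t2 : ∑' e, ∑' b, ∑' j, ENNReal.ofReal (w e j b) * ENNReal.ofReal (h j) ≤
      ∑' j, r j * ENNReal.ofReal (h j) := by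
    rw [(tsum_congr fun e => ENNReal.tsum_comm).trans ENNReal.tsum_comm]
    simp_rw [ENNReal.tsum_mul_right]
    exact ENNReal.tsum_le_tsum fun j => mul_le_mul_left (hr j) _
  have t3 : ∑' e, ∑' b, ∑' j, ENNReal.ofReal (w e j b) * ENNReal.ofReal (-Real.log (β b)) =
      ∑' b, ENNReal.ofReal (Real.negMulLog (β b)) := by
    rw [ENNReal.tsum_comm]
    simp_rw [ENNReal.tsum_mul_right, hβ]
    exact tsum_congr fun b => hmul _ (hβ0 b)
  -- Sum over `e` first, where `hq` gives at most `1`; then over `j` by `hh`; the sum of `β` left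
  -- over is `W`.
  have t4 : ∑' e, ∑' b, ∑' j, ENNReal.ofReal (Real.exp (-h j)) * ENNReal.ofReal (β b) *
      ENNReal.ofReal (w e j b / ε e) ≤ W := by
    rw [ENNReal.tsum_comm, hWb]
    refine ENNReal.tsum_le_tsum fun b => ?_
    rw [ENNReal.tsum_comm]
    simp_rw [ENNReal.tsum_mul_left]
    calc _ ≤ ∑' j, ENNReal.ofReal (Real.exp (-h j)) * ENNReal.ofReal (β b) * 1 :=
          ENNReal.tsum_le_tsum fun j => mul_le_mul_right (hq j b) _
      _ ≤ 1 * ENNReal.ofReal (β b) := by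
          simp_rw [mul_one]
          rw [ENNReal.tsum_mul_right]
          exact mul_le_mul_left hh _
      _ = _ := one_mul _
  rw [t1, t3] at key
  exact (ENNReal.add_le_add_iff_right hWfin).1
    (key.trans (add_le_add (add_le_add t2 le_rfl) t4))

end GibbsInequality

/-! ### Traces and entropies of states in arbitrary bases. -/

section Density

variable {H ι : Type*} [NormedAddCommGroup H] [InnerProductSpace ℂ H] [CompleteSpace H]

lemma posTrace_eq_one {T : H →L[ℂ] H} (hT : 0 ≤ T) (h : trace T = 1) : posTrace T = 1 := by
  have h1 : ∑' i, ‖CFC.sqrt T (stdBasis H i)‖ ^ 2 = 1 := by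
    rw [trace, tsum_congr fun i => inner_apply_eq_norm_sqrt_sq hT (stdBasis H i),
      ← Complex.ofReal_tsum] at h
    exact_mod_cast h
  -- A divergent `tsum` has default value `0`, so trace one forces convergence.
  have hs : Summable fun i => ‖CFC.sqrt T (stdBasis H i)‖ ^ 2 := by
    by_contra hs
    rw [tsum_eq_zero_of_not_summable hs] at h1
    exact zero_ne_one h1
  rw [posTrace_eq_hsSq_sqrt hT, hsSq, ← ENNReal.ofReal_tsum_of_nonneg (fun _ => by positivity) hs,
    h1, ENNReal.ofReal_one]

lemma entropy_eq_tsum (b : HilbertBasis ι ℂ H) {T : H →L[ℂ] H} (hT : IsSelfAdjoint T) {μ : ι → ℝ}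
    (h0 : ∀ i, 0 ≤ μ i) (h1 : ∀ i, μ i ≤ 1) (h : ∀ i, T (b i) = (μ i : ℂ) • b i) :
    entropy T = (∑' i, ENNReal.ofReal (Real.negMulLog (μ i))) / ENNReal.ofReal (Real.log 2) := by
  have hη : ∀ x : ℝ, -x * Real.logb 2 x = Real.negMulLog x / Real.log 2 := fun x => by
    rw [Real.logb, Real.negMulLog]; ring
  have hlog : 0 < Real.log 2 := Real.log_pos one_lt_two
  have hc : Continuous fun x : ℝ => -x * Real.logb 2 x := by
    simp_rw [hη]
    exact Real.continuous_negMulLog.div_const _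
  rw [entropy, posTrace_of_diag b (μ := fun i => -μ i * Real.logb 2 (μ i)), div_eq_mul_inv,
    ← ENNReal.tsum_mul_right]
  · refine tsum_congr fun i => ?_
    rw [hη, ENNReal.ofReal_div_of_pos hlog, div_eq_mul_inv]
  · intro i
    rw [hη]
    exact div_nonneg (Real.negMulLog_nonneg (h0 i) (h1 i)) hlog.le
  · exact fun i => cfc_apply_eigenvector hT hc (b.orthonormal.ne_zero i) (h i)

/-- If `T ≥ |v⟩⟨v|` then `⟨v, T⁻¹ v⟩ ≤ 1`, written in orthonormal eigenvectors of `T`. -/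
lemma tsum_norm_inner_sq_div_le_one {H κ : Type*} [NormedAddCommGroup H] [InnerProductSpace ℂ H]
    {c : κ → H} (hc : Orthonormal ℂ c) {T : H →L[ℂ] H}
    {ε : κ → ℝ} (hε : ∀ e, 0 ≤ ε e) (h : ∀ e, T (c e) = (ε e : ℂ) • c e) (v : H)
    (hv : ∀ x, ‖(inner ℂ v x : ℂ)‖ ^ 2 ≤ (inner ℂ x (T x)).re) :
    ∑' e, ENNReal.ofReal (‖(inner ℂ v (c e) : ℂ)‖ ^ 2 / ε e) ≤ 1 := by
  rw [ENNReal.tsum_eq_iSup_sum]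
  refine iSup_le fun F => ?_
  rw [← ENNReal.ofReal_sum_of_nonneg fun e _ => div_nonneg (by positivity) (hε e),
    ENNReal.ofReal_le_one]
  set s := ∑ e ∈ F, ‖(inner ℂ v (c e) : ℂ)‖ ^ 2 / ε e with hs
  have hs0 : 0 ≤ s := Finset.sum_nonneg fun e _ => div_nonneg (by positivity) (hε e)
  -- The test vector `∑ a e • c e` is `T⁻¹ v` cut to `F`. Both `⟨v, x⟩` and `⟨x, T x⟩` equal `s`
  -- there, so `hv` reads `s² ≤ s`. Where `ε e = 0`, division by zero makes the term vanish.
  let a : κ → ℂ := fun e => starRingEnd ℂ (inner ℂ v (c e)) / ε e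
  have h1 : inner ℂ v (∑ e ∈ F, a e • c e) = (s : ℂ) := by
    rw [inner_sum, hs, Complex.ofReal_sum]
    refine Finset.sum_congr rfl fun e _ => ?_
    rw [inner_smul_right, div_mul_eq_mul_div, mul_comm, Complex.mul_conj,
      Complex.normSq_eq_norm_sq]
    push_cast
    rfl
  have h2 : inner ℂ (∑ e ∈ F, a e • c e) (T (∑ e ∈ F, a e • c e)) = (s : ℂ) := by
    have : T (∑ e ∈ F, a e • c e) = ∑ e ∈ F, (a e * ε e) • c e := by
      rw [map_sum]
      exact Finset.sum_congr rfl fun e _ => by rw [map_smul, h, smul_smul]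
    rw [this, hc.inner_sum, hs, Complex.ofReal_sum]
    refine Finset.sum_congr rfl fun e _ => ?_
    rcases eq_or_ne (ε e) 0 with h0 | h0
    · simp [h0]
    have h0' : (ε e : ℂ) ≠ 0 := by exact_mod_cast h0
    simp only [a, map_div₀, Complex.conj_conj, Complex.conj_ofReal]
    rw [div_mul_cancel₀ _ h0', div_mul_eq_mul_div, Complex.mul_conj, Complex.normSq_eq_norm_sq]
    push_cast
    rfl
  have h3 := hv (∑ e ∈ F, a e • c e)
  rw [h1, h2, Complex.ofReal_re, Complex.norm_real, Real.norm_of_nonneg hs0] at h3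
  nlinarith

lemma hasSum_norm_sq (b : HilbertBasis ι ℂ H) {S : H →L[ℂ] H} (hS : hsSq S < ∞) :
    HasSum (fun i => ‖S (b i)‖ ^ 2) (hsSq S).toReal := by
  rw [← tsum_norm_sq_eq_hsSq b] at hS ⊢
  have := ENNReal.hasSum_toReal hS.ne
  simpa only [ENNReal.toReal_ofReal (sq_nonneg _), ENNReal.tsum_toReal_eq
    (fun i => ENNReal.ofReal_ne_top (r := ‖S (b i)‖ ^ 2))] using this

lemma hsSq_add_lt_top {S T : H →L[ℂ] H} (hS : hsSq S < ∞) (hT : hsSq T < ∞) :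
    hsSq (S + T) < ∞ := by
  refine lt_of_le_of_lt (b := 2 * hsSq S + 2 * hsSq T) ?_ (by finiteness)
  unfold hsSq
  rw [← ENNReal.tsum_mul_left, ← ENNReal.tsum_mul_left, ← ENNReal.tsum_add]
  refine ENNReal.tsum_le_tsum fun i => ?_
  rw [show (2 : ℝ≥0∞) = ENNReal.ofReal 2 by simp, ← ENNReal.ofReal_mul two_pos.le,
    ← ENNReal.ofReal_mul two_pos.le, ← ENNReal.ofReal_add (by positivity) (by positivity)]
  refine ENNReal.ofReal_le_ofReal ?_
  have h1 := norm_add_le (S (stdBasis H i)) (T (stdBasis H i))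
  rw [add_apply]
  nlinarith [norm_nonneg (S (stdBasis H i) + T (stdBasis H i)),
    sq_nonneg (‖S (stdBasis H i)‖ - ‖T (stdBasis H i)‖)]

lemma hsSq_mul_lt_top (D : H →L[ℂ] H) {S : H →L[ℂ] H} (hS : hsSq S < ∞) : hsSq (D * S) < ∞ := by
  refine lt_of_le_of_lt (b := ENNReal.ofReal (‖D‖ ^ 2) * hsSq S) ?_ (by finiteness)
  unfold hsSq
  rw [← ENNReal.tsum_mul_left]
  refine ENNReal.tsum_le_tsum fun i => ?_
  rw [← ENNReal.ofReal_mul (by positivity), ← mul_pow, mul_apply_eq_comp]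
  exact ENNReal.ofReal_le_ofReal (by gcongr; exact D.le_opNorm _)

lemma hsSq_neg (S : H →L[ℂ] H) : hsSq (-S) = hsSq S := by
  simp [hsSq]

/-- Polarization writes the sum through Hilbert–Schmidt norms, so its value does not depend on the
basis `b`. -/
lemma hasSum_re_inner (b : HilbertBasis ι ℂ H) {S T : H →L[ℂ] H} (hS : hsSq S < ∞)
    (hT : hsSq T < ∞) : HasSum (fun i => (inner ℂ (S (b i)) (T (b i))).re)
      (((hsSq (S + T)).toReal - (hsSq (S - T)).toReal) / 4) := by
  have h1 := hasSum_norm_sq b (hsSq_add_lt_top hS hT)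
  have h2 := hasSum_norm_sq b (S := S - T)
    (by rw [sub_eq_add_neg]; exact hsSq_add_lt_top hS (by rwa [hsSq_neg]))
  refine (congrArg (HasSum · _) (funext fun i => ?_)).mpr ((h1.sub h2).div_const 4)
  rw [add_apply, sub_apply, ← inner_self_eq_norm_sq (𝕜 := ℂ), ← inner_self_eq_norm_sq (𝕜 := ℂ)]
  have h3 := re_inner_eq_norm_add_mul_self_sub_norm_sub_mul_self_div_four (𝕜 := ℂ)
    (S (b i)) (T (b i))
  simp only [inner_self_eq_norm_sq]
  rw [sq, sq]
  exact h3

/-- With `S = √T`, `D T = (S D†)† S` is a product of Hilbert–Schmidt operators, so `hasSum_re_inner`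
moves the trace from the standard basis to `b`. -/
lemma hasSum_re_trace_mul (b : HilbertBasis ι ℂ H) (D : H →L[ℂ] H) {T : H →L[ℂ] H} (hT : 0 ≤ T)
    (h : posTrace T < ∞) :
    HasSum (fun i => (inner ℂ (b i) (D (T (b i)))).re) (trace (D * T)).re := by
  set S := CFC.sqrt T with hS
  have hSs : star S = S := (CFC.sqrt_nonneg T).isSelfAdjoint.star_eq
  have hSf : hsSq S < ∞ := by rwa [← posTrace_eq_hsSq_sqrt hT]
  have hZf : hsSq (S * star D) < ∞ := by
    rw [← hsSq_adjoint, star_mul, star_star, hSs]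
    exact hsSq_mul_lt_top D hSf
  have hin : ∀ x, inner ℂ ((S * star D) x) (S x) = inner ℂ x (D (T x)) := fun x => by
    rw [← ContinuousLinearMap.adjoint_inner_right, ← ContinuousLinearMap.star_eq_adjoint,
      star_mul, star_star, hSs, mul_apply_eq_comp, ← mul_apply_eq_comp S S,
      CFC.sqrt_mul_sqrt_self T hT]
  have hsum : Summable fun i => (inner ℂ (stdBasis H i) ((D * T) (stdBasis H i)) : ℂ) := by
    have hb := ((hasSum_norm_sq (stdBasis H) hZf).add
      (hasSum_norm_sq (stdBasis H) hSf)).summable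
    refine Summable.of_norm_bounded hb fun i => ?_
    rw [mul_apply_eq_comp, ← hin]
    have := norm_inner_le_norm (𝕜 := ℂ) ((S * star D) (stdBasis H i)) (S (stdBasis H i))
    nlinarith [sq_nonneg (‖(S * star D) (stdBasis H i)‖ - ‖S (stdBasis H i)‖),
      sq_nonneg ‖(S * star D) (stdBasis H i)‖, sq_nonneg ‖S (stdBasis H i)‖]
  have h1 := Complex.hasSum_re hsum.hasSum
  have h2 := hasSum_re_inner (stdBasis H) hZf hSf
  have h3 := hasSum_re_inner b hZf hSf
  simp_rw [hin] at h2 h3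
  rw [trace, h1.unique h2]
  exact h3

end Density

/-! ### Diagonal operators and mean energy. -/

section Energy

variable {A ι : Type*} [NormedAddCommGroup A] [InnerProductSpace ℂ A] [CompleteSpace A]

lemma inner_diagOp {A ι : Type*} [NormedAddCommGroup A] [InnerProductSpace ℂ A]
    (b : HilbertBasis ι ℂ A) (f : ι → ℝ) (hf : ∃ C, ∀ i, |f i| ≤ C) (i : ι)
    (x : A) : inner ℂ (b i) (diagOp b f hf x) = (f i : ℂ) * inner ℂ (b i) x := by
  rw [← b.repr_apply_apply, ← b.repr_apply_apply]
  have : b.repr (diagOp b f hf x) = diagL2 f hf.choose hf.choose_spec (b.repr x) :=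
    b.repr.apply_symm_apply _
  rw [this]
  rfl

lemma diagOp_apply_basis {A ι : Type*} [NormedAddCommGroup A] [InnerProductSpace ℂ A]
    (b : HilbertBasis ι ℂ A) (f : ι → ℝ) (hf : ∃ C, ∀ i, |f i| ≤ C) (i : ι) :
    diagOp b f hf (b i) = (f i : ℂ) • b i := by
  classical
  refine b.repr.injective (lp.ext (funext fun j => ?_))
  rw [b.repr_apply_apply, inner_diagOp, b.repr_apply_apply, inner_smul_right,
    orthonormal_iff_ite.1 b.orthonormal]
  split_ifs with h <;> simp [h]

namespace EnergyObservable

variable (G : EnergyObservable A ι)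

lemma posTrace_boltzmann (β : ℝ) (hβ : 0 < β) :
    posTrace (G.boltzmann β hβ) = ∑' j, ENNReal.ofReal (Real.exp (-β * G.energy j)) :=
  posTrace_of_diag G.basis (fun _ => (Real.exp_pos _).le)
    fun i => diagOp_apply_basis G.basis _ _ i

lemma tsum_le_mean {ρ : A →L[ℂ] A} (hρ : 0 ≤ ρ) (h : posTrace ρ < ∞) :
    ∑' j, ENNReal.ofReal (‖CFC.sqrt ρ (G.basis j)‖ ^ 2) * ENNReal.ofReal (G.energy j) ≤
      G.mean ρ := by
  rw [ENNReal.tsum_eq_iSup_sum]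
  refine iSup_le fun F => ?_
  -- A cutoff above the sum of the energies in `F` exceeds each of them, so one truncation already
  -- sees all terms of the partial sum.
  obtain ⟨n, hn⟩ := exists_nat_ge (∑ j ∈ F, G.energy j)
  have hFn : ∀ j ∈ F, G.energy j ≤ n := fun j hj =>
    (Finset.single_le_sum (fun i _ => G.energy_nonneg i) hj).trans hn
  let d : ι → ℝ := fun j => if G.energy j ≤ n then G.energy j else 0
  have hd : ∀ j, 0 ≤ d j := fun j => by
    simp only [d]; split_ifs; exacts [G.energy_nonneg j, le_rfl]
  have hsum := hasSum_re_trace_mul G.basis (G.truncation n) hρ h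
  have hterm : ∀ j, (inner ℂ (G.basis j) (G.truncation n (ρ (G.basis j)))).re =
      ‖CFC.sqrt ρ (G.basis j)‖ ^ 2 * d j := fun j => by
    rw [truncation, inner_diagOp, inner_apply_eq_norm_sqrt_sq hρ, ← Complex.ofReal_mul,
      Complex.ofReal_re, mul_comm]
  simp_rw [hterm] at hsum
  refine le_trans ?_ (le_iSup _ n)
  rw [← hsum.tsum_eq, ENNReal.ofReal_tsum_of_nonneg
    (fun j => mul_nonneg (sq_nonneg _) (hd j)) hsum.summable]
  refine le_trans (Finset.sum_le_sum fun j hj => ?_) (ENNReal.sum_le_tsum F)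
  rw [← ENNReal.ofReal_mul (sq_nonneg _), show d j = G.energy j from if_pos (hFn j hj)]

end EnergyObservable

end Energy

/-! ### Partial traces of operators of the form `Q† Q`. -/

section PartialTrace

/-- Each term is `(Q L_l)† (Q L_l)`, of norm `‖Q L_l‖²`, which the Hilbert–Schmidt sum dominates.
Hence the operator series converges in norm and its quadratic form may be computed termwise. Both
partial traces are instances. -/
lemma nonneg_and_inner_tsum_conj {H M K κ ν : Type*}
    [NormedAddCommGroup H] [InnerProductSpace ℂ H] [CompleteSpace H]
    [NormedAddCommGroup M] [InnerProductSpace ℂ M] [CompleteSpace M]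
    [NormedAddCommGroup K] [InnerProductSpace ℂ K] [CompleteSpace K]
    (c : HilbertBasis ν ℂ H) (L : κ → H →L[ℂ] M) (Q : M →L[ℂ] K)
    (hfin : ∑' l, ∑' k, ENNReal.ofReal (‖Q (L l (c k))‖ ^ 2) < ∞) {σ : H →L[ℂ] H}
    (hσ : σ = ∑' l, (L l).adjoint ∘L (Q.adjoint ∘L Q) ∘L L l) :
    0 ≤ σ ∧ ∀ x, ENNReal.ofReal (inner ℂ x (σ x)).re =
      ∑' l, ENNReal.ofReal (‖Q (L l x)‖ ^ 2) := by
  have hcomp : ∀ l, (L l).adjoint ∘L (Q.adjoint ∘L Q) ∘L L l =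
      (Q ∘L L l).adjoint ∘L (Q ∘L L l) := fun l => by
    rw [ContinuousLinearMap.adjoint_comp]; rfl
  simp_rw [hcomp] at hσ
  have hs : Summable fun l => (Q ∘L L l).adjoint ∘L (Q ∘L L l) := by
    refine Summable.of_norm ?_
    simp_rw [ContinuousLinearMap.norm_adjoint_comp_self, ← sq]
    have h1 : ∑' l, ENNReal.ofReal (‖Q ∘L L l‖ ^ 2) ≠ ∞ :=
      ((ENNReal.tsum_le_tsum fun l => ofReal_opNorm_sq_le c (Q ∘L L l)).trans_lt hfin).ne
    simpa only [ENNReal.toReal_ofReal (sq_nonneg _)] using ENNReal.summable_toReal h1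
  have hx : ∀ x, HasSum (fun l => ((‖Q (L l x)‖ ^ 2 : ℝ) : ℂ)) (inner ℂ x (σ x)) := fun x => by
    have h1 := (hs.hasSum.mapL (ContinuousLinearMap.apply ℂ H x)).mapL (innerSL ℂ x)
    rw [← hσ] at h1
    refine (congrArg (HasSum · _) (funext fun l => ?_)).mpr h1
    rw [ContinuousLinearMap.apply_apply, innerSL_apply_apply, ContinuousLinearMap.comp_apply,
      ContinuousLinearMap.adjoint_inner_right, inner_self_eq_norm_sq_to_K]
    norm_cast
  have hre : ∀ x, HasSum (fun l => ‖Q (L l x)‖ ^ 2) (inner ℂ x (σ x)).re := fun x => by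
    simpa only [Complex.ofReal_re] using Complex.hasSum_re (hx x)
  refine ⟨?_, fun x => ?_⟩
  · rw [ContinuousLinearMap.nonneg_iff_isPositive, ContinuousLinearMap.isPositive_iff_complex]
    intro x
    have him : ((inner ℂ x (σ x)).re : ℂ) = inner ℂ x (σ x) :=
      ((Complex.hasSum_ofReal).2 (hre x)).unique (hx x)
    rw [← inner_conj_symm, ← him]
    simp only [Complex.conj_ofReal, RCLike.re_to_complex, Complex.ofReal_re, true_and]
    exact (hre x).nonneg fun l => sq_nonneg _
  · rw [← (hre x).tsum_eq, ENNReal.ofReal_tsum_of_nonneg (fun _ => sq_nonneg _) (hre x).summable]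

variable {B E : Type*} [NormedAddCommGroup B] [InnerProductSpace ℂ B]
  [NormedAddCommGroup E] [InnerProductSpace ℂ E]

lemma inner_tensorLeft (b b' : B) (e e' : E) :
    inner ℂ (tensorLeft b e) (tensorLeft b' e') = (inner ℂ b b' : ℂ) * inner ℂ e e' := by
  change inner ℂ ((b ⊗ₜ[ℂ] e : B ⊗[ℂ] E) : HTensor B E)
    ((b' ⊗ₜ[ℂ] e' : B ⊗[ℂ] E) : HTensor B E) = _
  rw [UniformSpace.Completion.inner_coe, TensorProduct.inner_tmul]

lemma orthonormal_tensor {κ ν : Type*} {b : ν → B} {c : κ → E} (hb : Orthonormal ℂ b)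
    (hc : Orthonormal ℂ c) : Orthonormal ℂ fun p : κ × ν => tensorLeft (b p.2) (c p.1) := by
  classical
  rw [orthonormal_iff_ite] at *
  rintro ⟨e, b⟩ ⟨e', b'⟩
  rw [inner_tensorLeft, hb, hc]
  simp only [Prod.mk.injEq]
  split_ifs <;> simp_all

end PartialTrace

lemma exists_eigenbasis_of_posTrace_le_one {H : Type u} [NormedAddCommGroup H]
    [InnerProductSpace ℂ H] [CompleteSpace H] {T : H →L[ℂ] H} (hT : 0 ≤ T) (h : posTrace T ≤ 1) :
    ∃ (s : Type u) (b : HilbertBasis s ℂ H) (μ : s → ℝ), (∀ i, T (b i) = (μ i : ℂ) • b i) ∧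
      (∀ i, (inner ℂ (b i) (T (b i))).re = μ i) ∧ (∀ i, 0 ≤ μ i) ∧ ∀ i, μ i ≤ 1 := by
  obtain ⟨s, b, μ, hb⟩ := exists_eigenbasis hT (h.trans_lt ENNReal.one_lt_top)
  have hμ : ∀ i, (inner ℂ (b i) (T (b i))).re = μ i := fun i => by
    rw [hb, inner_smul_right, inner_self_eq_norm_sq_to_K, b.orthonormal.1]
    simp
  refine ⟨s, b, μ, hb, hμ, fun i => ?_, fun i => ?_⟩
  · rw [← hμ, inner_apply_eq_norm_sqrt_sq hT, Complex.ofReal_re]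
    positivity
  · rw [← ENNReal.ofReal_le_one, ← hμ]
    exact (ENNReal.le_tsum i).trans ((posTrace_eq_tsum b hT).symm.trans_le h)

/-! ### Entropy comparison of the two marginals. -/

section Marginals

variable {A B E ι : Type*} [NormedAddCommGroup A] [InnerProductSpace ℂ A] [CompleteSpace A]
  [NormedAddCommGroup B] [InnerProductSpace ℂ B] [NormedAddCommGroup E] [InnerProductSpace ℂ E]

/-- Bessel for the product family suffices: the Gibbs inequality needs only an upper bound on the
`A`-marginal. -/
lemma tsum_norm_inner_tensor_sq_le {κ ν : Type*} {b : ν → B} {c : κ → E} (hb : Orthonormal ℂ b)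
    (hc : Orthonormal ℂ c) (Q : HTensor B E →L[ℂ] A) (x : A) :
    ∑' e, ∑' l, ENNReal.ofReal (‖(inner ℂ x (Q (tensorLeft (b l) (c e))) : ℂ)‖ ^ 2) ≤
      ENNReal.ofReal (‖Q.adjoint x‖ ^ 2) := by
  refine le_trans (le_of_eq ?_) (bessel (orthonormal_tensor hb hc) (Q.adjoint x))
  rw [ENNReal.tsum_prod']
  refine tsum_congr fun e => tsum_congr fun l => ?_
  rw [← ContinuousLinearMap.adjoint_inner_left, ← inner_conj_symm, RCLike.norm_conj]

lemma tsum_norm_tensor_sq_le {κ ν : Type*} {b : ν → B} {c : κ → E} (hb : Orthonormal ℂ b)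
    (hc : Orthonormal ℂ c) (g : HilbertBasis ι ℂ A) (Q : HTensor B E →L[ℂ] A) :
    ∑' e, ∑' l, ENNReal.ofReal (‖Q (tensorLeft (b l) (c e))‖ ^ 2) ≤
      ∑' j, ENNReal.ofReal (‖Q.adjoint (g j)‖ ^ 2) := by
  refine le_trans (le_of_eq ?_)
    (ENNReal.tsum_le_tsum fun j => tsum_norm_inner_tensor_sq_le hb hc Q (g j))
  simp_rw [← parseval g (Q _)]
  exact (tsum_congr fun e => ENNReal.tsum_comm).trans ENNReal.tsum_comm

variable [CompleteSpace B] [CompleteSpace E]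

/-- Basis independence of the Hilbert–Schmidt sum of `Q (x ⊗ ·)` replaces the standard basis of `E`
by any `c`, later the eigenbasis of the other marginal. -/
lemma partialTraceE_apply (g : HilbertBasis ι ℂ A) {Q : HTensor B E →L[ℂ] A}
    (hQ : ∑' j, ENNReal.ofReal (‖Q.adjoint (g j)‖ ^ 2) ≤ 1) {ν : Type*} (c : HilbertBasis ν ℂ E) :
    0 ≤ partialTraceE (Q.adjoint ∘L Q) ∧
      posTrace (partialTraceE (Q.adjoint ∘L Q)) ≤ 1 ∧
      ∀ x, ENNReal.ofReal (inner ℂ x (partialTraceE (Q.adjoint ∘L Q) x)).re =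
        ∑' e, ENNReal.ofReal (‖Q (tensorLeft x (c e))‖ ^ 2) := by
  have hle := (tsum_norm_tensor_sq_le (stdBasis B).orthonormal (stdBasis E).orthonormal g Q).trans
    hQ
  obtain ⟨h0, h1⟩ := nonneg_and_inner_tsum_conj (stdBasis B)
    (fun l => tensorRight (B := B) (stdBasis E l)) Q (hle.trans_lt ENNReal.one_lt_top)
    (σ := partialTraceE (Q.adjoint ∘L Q)) rfl
  refine ⟨h0, ?_, fun x => ?_⟩
  · unfold posTrace
    simp_rw [h1]
    rw [ENNReal.tsum_comm]
    exact hle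
  · rw [h1]
    exact (tsum_norm_sq_adjoint (stdBasis E) g (Q ∘L tensorLeft x)).trans
      (tsum_norm_sq_adjoint c g (Q ∘L tensorLeft x)).symm

lemma partialTraceB_apply (g : HilbertBasis ι ℂ A) {Q : HTensor B E →L[ℂ] A}
    (hQ : ∑' j, ENNReal.ofReal (‖Q.adjoint (g j)‖ ^ 2) ≤ 1) {ν : Type*} (b : HilbertBasis ν ℂ B) :
    0 ≤ partialTraceB (Q.adjoint ∘L Q) ∧
      posTrace (partialTraceB (Q.adjoint ∘L Q)) ≤ 1 ∧
      ∀ x, ENNReal.ofReal (inner ℂ x (partialTraceB (Q.adjoint ∘L Q) x)).re =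
        ∑' l, ENNReal.ofReal (‖Q (tensorLeft (b l) x)‖ ^ 2) := by
  have hle := (tsum_norm_tensor_sq_le (stdBasis B).orthonormal (stdBasis E).orthonormal g Q).trans
    hQ
  obtain ⟨h0, h1⟩ := nonneg_and_inner_tsum_conj (stdBasis E)
    (fun l => tensorLeft (E := E) (stdBasis B l)) Q
    ((ENNReal.tsum_comm.trans_le hle).trans_lt ENNReal.one_lt_top)
    (σ := partialTraceB (Q.adjoint ∘L Q)) rfl
  refine ⟨h0, ?_, fun x => ?_⟩
  · unfold posTrace
    simp_rw [h1]
    exact hle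
  · rw [h1]
    exact (tsum_norm_sq_adjoint (stdBasis B) g (Q ∘L tensorRight x)).trans
      (tsum_norm_sq_adjoint b g (Q ∘L tensorRight x)).symm

/-- The marginals of the subnormalized state `Q† Q` on `B ⊗ E` satisfy
`H(σ_E) ≤ H(σ_B) + ∑ⱼ hⱼ ‖Q† gⱼ‖² / log 2` for all weights `h` with `∑ⱼ exp (-hⱼ) ≤ 1`. -/
lemma entropy_partialTraceB_le (g : HilbertBasis ι ℂ A) (h : ι → ℝ)
    (hh : ∑' j, ENNReal.ofReal (Real.exp (-h j)) ≤ 1) {Q : HTensor B E →L[ℂ] A}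
    (hQ : ∑' j, ENNReal.ofReal (‖Q.adjoint (g j)‖ ^ 2) ≤ 1) :
    entropy (partialTraceB (Q.adjoint ∘L Q)) ≤
      (∑' j, ENNReal.ofReal (‖Q.adjoint (g j)‖ ^ 2) * ENNReal.ofReal (h j)) /
        ENNReal.ofReal (Real.log 2) + entropy (partialTraceE (Q.adjoint ∘L Q)) := by
  obtain ⟨hB0, hB1, -⟩ := partialTraceE_apply g hQ (stdBasis E)
  obtain ⟨hE0, hE1, -⟩ := partialTraceB_apply g hQ (stdBasis B)
  obtain ⟨ν, b, β, hb, hbβ, hβ0, hβ1⟩ := exists_eigenbasis_of_posTrace_le_one hB0 hB1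
  obtain ⟨κ, c, ε, hc, hcε, hε0, hε1⟩ := exists_eigenbasis_of_posTrace_le_one hE0 hE1
  have hσB := (partialTraceE_apply g hQ c).2.2
  have hσE := (partialTraceB_apply g hQ b).2.2
  rw [entropy_eq_tsum c hE0.isSelfAdjoint hε0 hε1 hc,
    entropy_eq_tsum b hB0.isSelfAdjoint hβ0 hβ1 hb,
    ← ENNReal.add_div]
  refine ENNReal.div_le_div_right ?_ _
  refine tsum_negMulLog_le
    (fun e j l => ‖(inner ℂ (g j) (Q (tensorLeft (b l) (c e))) : ℂ)‖ ^ 2) (fun _ _ _ => sq_nonneg _)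
    ε β h _ hε0 hβ0 hε1 (fun e => ?_) (fun l => ?_)
    (fun j => tsum_norm_inner_tensor_sq_le b.orthonormal c.orthonormal Q (g j))
    (hQ.trans_lt ENNReal.one_lt_top).ne (fun j l => ?_) hh
  · simp_rw [parseval g]
    rw [← hσE, hcε]
  · simp_rw [parseval g]
    rw [← hσB, hbβ]
  -- Take `v = (Q (b_l ⊗ ·))† g_j`. The form `⟨x, σ_E x⟩ = ∑ₗ ‖Q (b_l ⊗ x)‖²` dominates its `l`-th
  -- term, hence `|⟨g_j, Q (b_l ⊗ x)⟩|² = |⟨v, x⟩|²`.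
  · have hin : ∀ x, (inner ℂ ((Q ∘L tensorLeft (b l)).adjoint (g j)) x : ℂ) =
        inner ℂ (g j) (Q (tensorLeft (b l) x)) := fun x =>
      ContinuousLinearMap.adjoint_inner_left _ _ _
    simp_rw [← hin]
    refine tsum_norm_inner_sq_div_le_one c.orthonormal hε0 hc _ fun x => ?_
    have hpos : 0 ≤ (inner ℂ x (partialTraceB (Q.adjoint ∘L Q) x)).re := by
      rw [inner_apply_eq_norm_sqrt_sq hE0, Complex.ofReal_re]
      positivity
    rw [← ENNReal.ofReal_le_ofReal_iff hpos, hσE, hin]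
    refine le_trans (ENNReal.ofReal_le_ofReal ?_) (ENNReal.le_tsum l)
    have := norm_inner_le_norm (𝕜 := ℂ) (g j) (Q (tensorLeft (b l) x))
    rw [g.orthonormal.1, one_mul] at this
    gcongr

/-- Apply `entropy_partialTraceB_le` to `Q = √ρ U†`; as `U` is isometric, `‖Q† g_j‖ = ‖√ρ g_j‖`. -/
lemma entropy_complementary_le (g : HilbertBasis ι ℂ A) (h : ι → ℝ)
    (hh : ∑' j, ENNReal.ofReal (Real.exp (-h j)) ≤ 1) (U : A →ₗᵢ[ℂ] HTensor B E)
    {ρ : A →L[ℂ] A} (hρ : 0 ≤ ρ) (htr : posTrace ρ = 1) :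
    entropy (partialTraceB
        (U.toContinuousLinearMap ∘L ρ ∘L U.toContinuousLinearMap.adjoint)) ≤
      (∑' j, ENNReal.ofReal (‖CFC.sqrt ρ (g j)‖ ^ 2) * ENNReal.ofReal (h j)) /
        ENNReal.ofReal (Real.log 2) + entropy (partialTraceE
        (U.toContinuousLinearMap ∘L ρ ∘L U.toContinuousLinearMap.adjoint)) := by
  let S : A →L[ℂ] A := CFC.sqrt ρ
  have hSs : S.adjoint = S := (CFC.sqrt_nonneg ρ).isSelfAdjoint.star_eq
  have hSS : S ∘L S = ρ := CFC.sqrt_mul_sqrt_self ρ hρ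
  let V : A →L[ℂ] HTensor B E := U.toContinuousLinearMap
  have hQa : (S ∘L V.adjoint).adjoint = V ∘L S := by
    rw [ContinuousLinearMap.adjoint_comp, ContinuousLinearMap.adjoint_adjoint, hSs]
  have hX : V ∘L ρ ∘L V.adjoint = (S ∘L V.adjoint).adjoint ∘L (S ∘L V.adjoint) := by
    rw [hQa, ← hSS]
    simp only [ContinuousLinearMap.comp_assoc]
  have hQn : ∀ x, ‖(S ∘L V.adjoint).adjoint x‖ = ‖CFC.sqrt ρ x‖ := fun x => by
    rw [hQa]
    exact U.norm_map _
  have hQ : ∑' j, ENNReal.ofReal (‖(S ∘L V.adjoint).adjoint (g j)‖ ^ 2) ≤ 1 := by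
    simp_rw [hQn]
    rw [tsum_norm_sq_eq_hsSq, ← posTrace_eq_hsSq_sqrt hρ, htr]
  have key := entropy_partialTraceB_le g h hh hQ
  simp_rw [hQn] at key
  rw [← hX] at key
  exact key

end Marginals

end QInfo

/-! ### The main theorem. -/

theorem mainTheorem11 {A B E ι : Type*}
    [NormedAddCommGroup A] [InnerProductSpace ℂ A] [CompleteSpace A]
    [NormedAddCommGroup B] [InnerProductSpace ℂ B] [CompleteSpace B]
    [NormedAddCommGroup E] [InnerProductSpace ℂ E] [CompleteSpace E]
    (N : QInfo.QuantumChannel A B) (G : QInfo.EnergyObservable A ι) (hG : G.IsGibbs) (P : ℝ≥0)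
    (hN : QInfo.FiniteOutputEntropy N.toLinearMap G P)
    (Nc : QInfo.traceClass A →ₗ[ℂ] QInfo.traceClass E)
    (hc : QInfo.IsComplementary N.toLinearMap Nc) :
    QInfo.FiniteOutputEntropy Nc G P := by
  open QInfo in
  obtain ⟨U, hU⟩ := hc
  have hZ := hG 1 one_pos
  rw [G.posTrace_boltzmann] at hZ
  set Z := ∑' j, ENNReal.ofReal (Real.exp (-1 * G.energy j)) with hZdef
  -- The weights are `h_j = g_j + log c`, for which `∑ⱼ exp(-h_j) = Z / c ≤ 1`; the summand `1`
  -- keeps `c` positive even when the basis is empty and `Z = 0`.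
  set c := 1 + Z.toReal with hcdef
  have hc1 : 1 ≤ c := by simp [hcdef]
  have hc0 : 0 < c := one_pos.trans_le hc1
  have hh : ∑' j, ENNReal.ofReal (Real.exp (-(G.energy j + Real.log c))) ≤ 1 := by
    have : ∀ j, ENNReal.ofReal (Real.exp (-(G.energy j + Real.log c))) =
        ENNReal.ofReal (Real.exp (-1 * G.energy j)) / ENNReal.ofReal c := fun j => by
      rw [← ENNReal.ofReal_div_of_pos hc0, neg_add, Real.exp_add, Real.exp_neg (Real.log c),
        Real.exp_log hc0, neg_one_mul, div_eq_mul_inv]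
    simp_rw [this, div_eq_mul_inv]
    rw [ENNReal.tsum_mul_right, ← hZdef, ← div_eq_mul_inv]
    refine ENNReal.div_le_of_le_mul ?_
    rw [one_mul, ← ENNReal.ofReal_toReal hZ.ne]
    exact ENNReal.ofReal_le_ofReal (by simp [hcdef])
  unfold FiniteOutputEntropy at hN ⊢
  refine lt_of_le_of_lt (b := (P + ENNReal.ofReal (Real.log c)) / ENNReal.ofReal (Real.log 2) +
    ⨆ (ρ : traceClass A) (_ : IsDensity ρ) (_ : G.mean ρ ≤ P),
      entropy (N.toLinearMap ρ : B →L[ℂ] B))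
    ?_ ?_
  · refine iSup_le fun ρ => iSup_le fun hρ => iSup_le fun hm => ?_
    have hρ0 : 0 ≤ (ρ : A →L[ℂ] A) := (ContinuousLinearMap.nonneg_iff_isPositive _).2 hρ.1
    have htr := posTrace_eq_one hρ0 hρ.2
    rw [(hU ρ).2]
    refine (entropy_complementary_le G.basis _ hh U hρ0 htr).trans (add_le_add ?_ ?_)
    · refine ENNReal.div_le_div_right ?_ _
      calc _ ≤ ∑' j, (ENNReal.ofReal (‖CFC.sqrt (ρ : A →L[ℂ] A) (G.basis j)‖ ^ 2) *
              ENNReal.ofReal (G.energy j) +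
            ENNReal.ofReal (‖CFC.sqrt (ρ : A →L[ℂ] A) (G.basis j)‖ ^ 2) *
              ENNReal.ofReal (Real.log c)) := by
            refine ENNReal.tsum_le_tsum fun j => ?_
            rw [← mul_add]
            exact mul_le_mul_right ENNReal.ofReal_add_le _
        _ ≤ _ := by
            rw [ENNReal.tsum_add, ENNReal.tsum_mul_right, tsum_norm_sq_eq_hsSq,
              ← posTrace_eq_hsSq_sqrt hρ0, htr, one_mul]
            exact add_le_add_left ((G.tsum_le_mean hρ0 (htr ▸ ENNReal.one_lt_top)).trans hm) _
    · rw [← (hU ρ).1]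
      exact le_iSup_of_le ρ (le_iSup_of_le hρ (le_iSup_of_le hm le_rfl))
  · have hlog : ENNReal.ofReal (Real.log 2) ≠ 0 := by
      rw [Ne, ENNReal.ofReal_eq_zero, not_le]
      exact Real.log_pos one_lt_two
    exact ENNReal.add_lt_top.2 ⟨ENNReal.div_lt_top (by finiteness) hlog, hN⟩
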